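/- For $n$ odd and $x\in\{-1,1\}^n$, with coordinates indexed cyclically (so that coordinates $1$ and $n$ are adjacent), let $M_n(x)\in\{-1,1\}^n$ be given by \[M_n(x)(i)=\mathrm{sign}\bigl(x(i-1)+x(i)+x(i+1)\bigr),\qquad i\in\mathbb{Z}/n\mathbb{Z}.\] For $T\ge 0$ let $f_{n,T}:\{-1,1\}^n\to\{-1,1\}$ be the convolutional iterated $3$-majority function with stride $1$ and $T$ layers on the $n$-cycle, that is, \[f_{n,T}(\omega)=\mathrm{sign}\Bigl(\sum_{i=1}^n M_n^{T}(\omega)(i)\Bigr),\] where $M_n^T$ is the $T$-fold iterate of $M_n$. Let $\omega$ be uniformly distributed on $\{-1,1\}^n$ and, for $0\le\epsilon\le1$, let $\omega^\epsilon$ be obtained from $\omega$ by flipping the sign of each coordinate independently with probability $\epsilon$. Theorem. For every sequence $(T_n)_n$ of non-negative integers, the sequence $(f_{n,T_n})_{n\ \mathrm{odd}}$ is noise stable, i.e. \[\lim_{\epsilon\downarrow 0}\ \sup_{n\ \mathrm{odd}}\ \mathrm{P}\bigl(f_{n,T_n}(\omega)\ne f_{n,T_n}(\omega^\epsilon)\bigr)=0.\]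 -/

import Mathlib

open Filter Topology MeasureTheory

noncomputable section

/- The two-point set `{-1, 1}` is the type `ℤˣ` of units of `ℤ`. -/

/-- All subsets of `ℤˣ` are measurable. -/
instance : DiscreteMeasurableSpace ℤˣ :=
  ⟨fun s => ⟨Units.val '' s, MeasurableSet.of_discrete, Set.preimage_image_eq s Units.val_injective⟩⟩

/-- The majority of a finite family of signs, i.e. the sign of their sum. It is only used for
families of odd size, where the sum is never zero. -/
def majority {ι : Type*} [Fintype ι] (x : ι → ℤˣ) : ℤˣ :=
  if 0 < ∑ i, ((x i : ℤˣ) : ℤ) then 1 else -1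

/-- One layer of 3-majority with stride 1 on the `n`-cycle: the output at node `i` is the majority
of the inputs at the nodes `i - 1`, `i`, `i + 1`, indices being cyclic
(`finRotate n` is the cyclic shift `i ↦ i + 1` of `Fin n`). -/
def cycleLayer (n : ℕ) (x : Fin n → ℤˣ) : Fin n → ℤˣ :=
  fun i => majority ![x ((finRotate n).symm i), x i, x (finRotate n i)]

/-- The convolutional iterated 3-majority function with stride 1 on the `n`-cycle, with `T` layers:
the majority of all `n` values in layer `T`. -/
def cycleIteratedMajority (n T : ℕ) (ω : Fin n → ℤˣ) : ℤˣ :=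
  majority ((cycleLayer n)^[T] ω)

/-- The law of a random sign that equals `-1` with probability `p` and `1` with probability
`1 - p`, for `0 ≤ p ≤ 1`. -/
def signLaw (p : ℝ) : Measure ℤˣ :=
  ENNReal.ofReal (1 - p) • Measure.dirac 1 + ENNReal.ofReal p • Measure.dirac (-1)

/-- The joint law of a uniform random input `ω` (independent fair signs) and an independent noise
vector `η` whose coordinates are independent and equal to `-1` with probability `ε`. -/
def noiseLaw (N : ℕ) (ε : ℝ) : Measure ((Fin N → ℤˣ) × (Fin N → ℤˣ)) :=
  (Measure.pi fun _ => signLaw (1 / 2)).prod (Measure.pi fun _ => signLaw ε)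

/-- The probability that `f ω ≠ f ω^ε`, where `ω^ε = ω * η` is obtained from the uniform `ω` by
flipping each coordinate independently with probability `ε`. -/
def disagreementProb {N : ℕ} (f : (Fin N → ℤˣ) → ℤˣ) (ε : ℝ) : ENNReal :=
  noiseLaw N ε {p | f p.1 ≠ f (p.1 * p.2)}

/-- A family of Boolean functions is noise stable if `sup_n P(f_n(ω) ≠ f_n(ω^ε)) → 0` as `ε ↓ 0`. -/
def NoiseStable {ι : Type*} {N : ι → ℕ} (f : (n : ι) → (Fin (N n) → ℤˣ) → ℤˣ) : Prop :=
  Tendsto (fun ε : ℝ => ⨆ n, disagreementProb (f n) ε) (𝓝[>] 0) (𝓝 0)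

end

/-! Let `S` be the sum of the signs in layer `T`. If `ω` and its noisy copy disagree, then either
`|S| ≤ K` or the noise moves `S` by at least `K`. Both are unlikely for `K = a√m`, with `m = n / 6`
and `a` small, by bounds that do not see `T`.

Everything rests on one fact: two neighbours with equal signs keep them forever. Hence a flip at `k`
can spread only along the alternating runs next to `k` (`reach_of_iterate_ne`). Their lengths have
geometric tails, so a flip changes `S` by `O(1)` in mean square (`sum_layerSum_sub_flipAt_sq_le`).
By the Efron–Stein type inequality `noise_sq_le`, the noise then changes `S` by `O(εn)` in mean
square.

For the small-ball bound, cut the cycle into blocks of six sites. With probability 1/8 a block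
consists of three pairs of equal signs. Its outer pairs then shield the rest of the cycle, and
reversing the middle pair changes `S` by exactly 4 in absolute value (`layerSum_flipPair`). A
Stein-type argument over these many local moves gives `P(|S| ≤ K) = O((K + 1)/√n)`
(`card_abs_le_of_moves`).

Small `n` are covered by the trivial bound `nε`. -/

/-- Flip the sign at one coordinate. -/
def flipAt {ι : Type*} [DecidableEq ι] (a : ι) (ω : ι → ℤˣ) : ι → ℤˣ :=
  Function.update ω a (-ω a)

/-! ### Coordinate flips and sums invariant under involutions -/

section Flip

variable {ι : Type*} [DecidableEq ι]

@[simp] lemma flipAt_self (a : ι) (ω : ι → ℤˣ) : flipAt a ω a = -ω a := by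
  simp [flipAt]

lemma flipAt_of_ne {a b : ι} (h : b ≠ a) (ω : ι → ℤˣ) : flipAt a ω b = ω b := by
  simp [flipAt, h]

lemma flipAt_involutive (a : ι) : Function.Involutive (flipAt a : (ι → ℤˣ) → ι → ℤˣ) := by
  intro ω
  simp [flipAt]

lemma sum_comp_involutive {α : Type*} [Fintype α] {τ : α → α} (hτ : Function.Involutive τ)
    (F : α → ℝ) : ∑ ω, F (τ ω) = ∑ ω, F ω :=
  Equiv.sum_comp hτ.toPerm F

/-- The involution exchanges `p` with its complement and preserves `h`, so both halves carry the
same mass. This replaces independence throughout. -/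
lemma sum_ite_eq_half_of_involutive {α : Type*} [Fintype α] {τ : α → α}
    (hτ : Function.Involutive τ) (p : α → Prop) [DecidablePred p] (hp : ∀ ω, p (τ ω) ↔ ¬ p ω)
    (h : α → ℝ) (hh : ∀ ω, h (τ ω) = h ω) :
    ∑ ω, (if p ω then h ω else 0) = (∑ ω, h ω) / 2 := by
  have h1 := sum_comp_involutive hτ (fun ω => if p ω then h ω else 0)
  have h2 : ∑ ω, (if p ω then h ω else 0) + ∑ ω, (if p (τ ω) then h (τ ω) else 0)
      = ∑ ω, h ω := by
    rw [← Finset.sum_add_distrib]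
    refine Finset.sum_congr rfl fun ω _ => ?_
    by_cases hc : p ω <;> simp [hp, hh, hc]
  linarith

end Flip

/-! ### Mean-square effect of noise -/

/-- The probability of the noise vector `η` when every sign is `-1` with probability `ε`. -/
def noiseWeight {n : ℕ} (ε : ℝ) (η : Fin n → ℤˣ) : ℝ :=
  ∏ i, if η i = 1 then 1 - ε else ε

section Noise

lemma noiseWeight_nonneg {n : ℕ} {ε : ℝ} (h0 : 0 ≤ ε) (h1 : ε ≤ 1) (η : Fin n → ℤˣ) :
    0 ≤ noiseWeight ε η :=
  Finset.prod_nonneg fun i _ => by split_ifs <;> linarith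

lemma sum_units (F : ℤˣ → ℝ) : ∑ s, F s = F 1 + F (-1) := by
  have : (Finset.univ : Finset ℤˣ) = {1, -1} := by decide
  rw [this, Finset.sum_pair (by decide)]

lemma sum_pi_succ {n : ℕ} (F : (Fin (n + 1) → ℤˣ) → ℝ) :
    ∑ ω, F ω = ∑ ω : Fin n → ℤˣ, (F (Fin.cons 1 ω) + F (Fin.cons (-1) ω)) := by
  rw [← Equiv.sum_comp (Fin.consEquiv fun _ => ℤˣ), Fintype.sum_prod_type, sum_units,
    ← Finset.sum_add_distrib]
  rfl

lemma noiseWeight_cons {n : ℕ} (ε : ℝ) (s : ℤˣ) (η : Fin n → ℤˣ) :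
    noiseWeight ε (Fin.cons s η : Fin (n + 1) → ℤˣ)
      = (if s = 1 then 1 - ε else ε) * noiseWeight ε η := by
  simp [noiseWeight, Fin.prod_univ_succ]

lemma sum_noiseWeight (n : ℕ) (ε : ℝ) : ∑ η : Fin n → ℤˣ, noiseWeight ε η = 1 := by
  induction n with
  | zero => simp [noiseWeight]
  | succ n ih =>
    rw [sum_pi_succ]
    simp only [noiseWeight_cons]
    refine Eq.trans (Finset.sum_congr rfl fun η _ => ?_) ih
    have : (-1 : ℤˣ) ≠ 1 := by decide
    simp only [if_true, if_neg this]
    ring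

lemma cons_mul_cons {n : ℕ} (s t : ℤˣ) (ω η : Fin n → ℤˣ) :
    (Fin.cons s ω * Fin.cons t η : Fin (n + 1) → ℤˣ) = Fin.cons (s * t) (ω * η) := by
  ext i
  refine Fin.cases ?_ (fun j => ?_) i <;> simp

lemma flipAt_zero_cons {n : ℕ} (s : ℤˣ) (ω : Fin n → ℤˣ) :
    flipAt 0 (Fin.cons s ω : Fin (n + 1) → ℤˣ) = Fin.cons (-s) ω := by
  simp [flipAt]

lemma flipAt_succ_cons {n : ℕ} (k : Fin n) (s : ℤˣ) (ω : Fin n → ℤˣ) :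
    flipAt k.succ (Fin.cons s ω : Fin (n + 1) → ℤˣ) = Fin.cons s (flipAt k ω) := by
  simp [flipAt, Fin.cons_update]

lemma sum_sum_noise_comp_mul {n : ℕ} (ε : ℝ) (F : (Fin n → ℤˣ) → ℝ) :
    ∑ ω, ∑ η, noiseWeight ε η * F (ω * η) = ∑ ω, F ω := by
  rw [Finset.sum_comm]
  have : ∀ η : Fin n → ℤˣ, ∑ ω, noiseWeight ε η * F (ω * η) = noiseWeight ε η * ∑ ω, F ω := by
    intro η
    rw [← Finset.mul_sum, ← Equiv.sum_comp (Equiv.mulRight η) F]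
    rfl
  simp_rw [this]
  rw [← Finset.sum_mul, sum_noiseWeight, one_mul]

lemma sum_sum_noise_const {n : ℕ} (ε : ℝ) (F : (Fin n → ℤˣ) → ℝ) :
    ∑ ω, ∑ η : Fin n → ℤˣ, noiseWeight ε η * F ω = ∑ ω, F ω := by
  simp_rw [← Finset.sum_mul, sum_noiseWeight, one_mul]

/-- The mean squared effect of noise is at most `ε` times the sum of the mean squared effects of
flipping single coordinates. -/
theorem noise_sq_le {ε : ℝ} (h0 : 0 ≤ ε) (h1 : ε ≤ 1) (n : ℕ) (g : (Fin n → ℤˣ) → ℝ) :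
    ∑ ω, ∑ η, noiseWeight ε η * (g ω - g (ω * η)) ^ 2
      ≤ ε * ∑ k, ∑ ω, (g ω - g (flipAt k ω)) ^ 2 := by
  induction n with
  | zero =>
    have : ∀ ω η : Fin 0 → ℤˣ, ω * η = ω := fun ω η => Subsingleton.elim _ _
    simp [this]
  | succ n ih =>
    have hne : (-1 : ℤˣ) ≠ 1 := by decide
    -- Even and odd parts of `g` in the first coordinate: `g = a ± b`. The induction hypothesis is
    -- applied to each.
    set a : (Fin n → ℤˣ) → ℝ := fun ω => (g (Fin.cons 1 ω) + g (Fin.cons (-1) ω)) / 2 with ha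
    set b : (Fin n → ℤˣ) → ℝ := fun ω => (g (Fin.cons 1 ω) - g (Fin.cons (-1) ω)) / 2 with hb
    have e1 : ∀ ω, g (Fin.cons 1 ω) = a ω + b ω := fun ω => by simp only [ha, hb]; ring
    have e2 : ∀ ω, g (Fin.cons (-1) ω) = a ω - b ω := fun ω => by simp only [ha, hb]; ring
    have hR : ∑ k, ∑ ω, (g ω - g (flipAt k ω)) ^ 2
        = 8 * ∑ ω, b ω ^ 2 + (2 * ∑ k, ∑ ω, (a ω - a (flipAt k ω)) ^ 2
          + 2 * ∑ k, ∑ ω, (b ω - b (flipAt k ω)) ^ 2) := by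
      rw [Fin.sum_univ_succ]
      congr 1
      · rw [sum_pi_succ, Finset.mul_sum]
        refine Finset.sum_congr rfl fun ω _ => ?_
        simp only [flipAt_zero_cons, neg_neg, e1, e2]
        ring
      · rw [Finset.mul_sum, Finset.mul_sum, ← Finset.sum_add_distrib]
        refine Finset.sum_congr rfl fun k _ => ?_
        rw [sum_pi_succ, Finset.mul_sum, Finset.mul_sum, ← Finset.sum_add_distrib]
        refine Finset.sum_congr rfl fun ω _ => ?_
        simp only [flipAt_succ_cons, e1, e2]
        ring
    have hL : ∑ ω, ∑ η, noiseWeight ε η * (g ω - g (ω * η)) ^ 2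
        ≤ ∑ ω, ∑ η, (2 * (noiseWeight ε η * (a ω - a (ω * η)) ^ 2)
          + 2 * (noiseWeight ε η * (b ω - b (ω * η)) ^ 2)
          + (4 * ε * (noiseWeight ε η * b ω ^ 2)
            + 4 * ε * (noiseWeight ε η * b (ω * η) ^ 2))) := by
      rw [sum_pi_succ]
      refine Finset.sum_le_sum fun ω _ => ?_
      rw [sum_pi_succ, sum_pi_succ, ← Finset.sum_add_distrib]
      refine Finset.sum_le_sum fun η _ => ?_
      simp only [cons_mul_cons, noiseWeight_cons, if_true, if_neg hne, mul_one, one_mul,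
        neg_mul_neg, e1, e2]
      have hw := noiseWeight_nonneg h0 h1 η
      -- After summing over the first coordinate, the two sides differ by exactly four times this
      -- term.
      have key : 0 ≤ (noiseWeight ε η * ε) * (b ω - b (ω * η)) ^ 2 := by positivity
      nlinarith [key]
    simp only [Finset.sum_add_distrib, ← Finset.mul_sum] at hL
    simp only [sum_sum_noise_comp_mul ε (fun ω => b ω ^ 2),
      sum_sum_noise_const ε (fun ω => b ω ^ 2)] at hL
    rw [hR]
    linarith [ih a, ih b]

end Noise

/-! ### Frozen pairs and the spread of a single flip -/

/-- One layer of 3-majority along the cycles of a permutation `r`. -/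
def permLayer {ι : Type*} (r : Equiv.Perm ι) (x : ι → ℤˣ) : ι → ℤˣ :=
  fun i => majority ![x (r.symm i), x i, x (r i)]

lemma majority_three (a b c : ℤˣ) :
    majority ![a, b, c] = if a = b then a else c := by
  revert a b c
  simp only [majority, Fin.sum_univ_three]
  decide

section Dynamics

variable {ι : Type*} (r : Equiv.Perm ι)

lemma permLayer_symm : permLayer r.symm = permLayer r := by
  funext x i
  simp only [permLayer, Equiv.symm_symm, majority_three]
  generalize x (r i) = a
  generalize x i = b
  generalize x (r.symm i) = c
  revert a b c
  decide

lemma permLayer_inv : permLayer r⁻¹ = permLayer r := permLayer_symm r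

/-- Each member of an equal adjacent pair already has two of the three votes it sees. -/
lemma permLayer_stable {x : ι → ℤˣ} {i : ι} (h : x i = x (r i)) :
    permLayer r x i = x i ∧ permLayer r x (r i) = x (r i) := by
  simp only [permLayer, Equiv.symm_apply_apply, majority_three, ← h]
  refine ⟨?_, by simp⟩
  split_ifs with h' <;> simp [h']

lemma iterate_permLayer_stable {x : ι → ℤˣ} {i : ι} (h : x i = x (r i)) (t : ℕ) :
    (permLayer r)^[t] x i = x i ∧ (permLayer r)^[t] x (r i) = x (r i) := by
  induction t with
  | zero => simp
  | succ t ih =>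
    rw [Function.iterate_succ_apply']
    have := permLayer_stable r (x := (permLayer r)^[t] x) (i := i) (by rw [ih.1, ih.2, h])
    rwa [ih.1, ih.2] at this

lemma permLayer_congr {x y : ι → ℤˣ} {i : ι} (h₁ : x (r.symm i) = y (r.symm i)) (h₂ : x i = y i)
    (h₃ : x (r i) = y (r i)) : permLayer r x i = permLayer r y i := by
  simp only [permLayer, h₁, h₂, h₃]

/-- The signs alternate along the `d + 1` sites `r k, r² k, …`. -/
def AltRun (k : ι) (ω : ι → ℤˣ) (d : ℕ) : Prop :=
  ∀ e < d, ω ((r ^ (e + 1)) k) ≠ ω ((r ^ (e + 2)) k)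

/-- The site `i` can be reached from `k` along a run of alternating signs. -/
def Reach (n : ℕ) (k : ι) (ω : ι → ℤˣ) (i : ι) : Prop :=
  i = k ∨ ∃ d < n - 1, i = (r ^ (d + 1)) k ∧ AltRun r k ω d

variable {r} [DecidableEq ι]

/-- A discrepancy at `j ≠ k` rules out an equal pair `j`, `r j` away from `k`, since that pair would
be frozen in both inputs. So the alternating run extends by one site, unless it has gone round the
cycle back to `k`. -/
lemma Reach.step {n t : ℕ} (hn : 0 < n) (hr : r ^ n = 1) {k : ι} {ω : ι → ℤˣ} {j : ι}
    (h : Reach r n k ω j)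
    (hj : (permLayer r)^[t] ω j ≠ (permLayer r)^[t] (flipAt k ω) j) :
    Reach r n k ω (r j) := by
  by_cases hjk : j = k
  · subst hjk
    rcases Nat.lt_or_ge 1 n with h1 | h1
    · exact Or.inr ⟨0, by omega, by simp, fun e he => by omega⟩
    · obtain rfl : n = 1 := by omega
      rw [pow_one] at hr
      exact Or.inl (by simp [hr])
  by_cases hrjk : r j = k
  · exact Or.inl hrjk
  obtain h | ⟨d, hd, hjd, hrun⟩ := h
  · exact absurd h hjk
  by_cases heq : ω j = ω (r j)
  · refine absurd ?_ hj
    have heq' : flipAt k ω j = flipAt k ω (r j) := by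
      rw [flipAt_of_ne hjk, flipAt_of_ne hrjk, heq]
    rw [(iterate_permLayer_stable r heq t).1, (iterate_permLayer_stable r heq' t).1,
      flipAt_of_ne hjk]
  · have hrj : r j = (r ^ (d + 1 + 1)) k := by rw [hjd, pow_succ' r (d + 1)]; rfl
    rcases Nat.lt_or_ge (d + 1) (n - 1) with h1 | h1
    · refine Or.inr ⟨d + 1, h1, hrj, fun e he => ?_⟩
      rcases Nat.lt_or_ge e d with h2 | h2
      · exact hrun e h2
      · obtain rfl : e = d := by omega
        rwa [← hjd, ← hrj]
    · obtain rfl : n = d + 1 + 1 := by omega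
      rw [hr] at hrj
      exact Or.inl hrj

/-- Moving back shortens the run. Only at `j = k` does the direction change, and there a run along
`r⁻¹` begins. -/
lemma Reach.step_back {n t : ℕ} (hn : 0 < n) (hr : r ^ n = 1) {k : ι} {ω : ι → ℤˣ} {j : ι}
    (h : Reach r n k ω j)
    (hj : (permLayer r)^[t] ω j ≠ (permLayer r)^[t] (flipAt k ω) j) :
    Reach r n k ω (r⁻¹ j) ∨ Reach r⁻¹ n k ω (r⁻¹ j) := by
  obtain h | ⟨d, hd, hjd, hrun⟩ := h
  · right
    refine Reach.step (t := t) hn (by rw [inv_pow, hr, inv_one]) (Or.inl h) ?_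
    rwa [permLayer_inv]
  · left
    have hrj : r⁻¹ j = (r ^ d) k := by rw [hjd, pow_succ' r d]; simp
    rcases d with _ | d
    · exact Or.inl (by simpa using hrj)
    · exact Or.inr ⟨d, by omega, hrj, fun e he => hrun e (by omega)⟩

/-- After any number of layers, the effect of flipping the input at `k` is confined to the
alternating runs that start next to `k`. -/
theorem reach_of_iterate_ne {n : ℕ} (hn : 0 < n) (hr : r ^ n = 1) {k : ι} {ω : ι → ℤˣ} (t : ℕ)
    (i : ι) (hi : (permLayer r)^[t] ω i ≠ (permLayer r)^[t] (flipAt k ω) i) :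
    Reach r n k ω i ∨ Reach r⁻¹ n k ω i := by
  induction t generalizing i with
  | zero =>
    left; left
    by_contra h
    exact hi (by simp [flipAt_of_ne h])
  | succ t ih =>
    have hr' : r⁻¹ ^ n = 1 := by rw [inv_pow, hr, inv_one]
    have hL : permLayer r⁻¹ = permLayer r := permLayer_inv r
    rw [Function.iterate_succ_apply', Function.iterate_succ_apply'] at hi
    by_cases h2 : (permLayer r)^[t] ω i = (permLayer r)^[t] (flipAt k ω) i
    swap
    · exact ih i h2
    -- A new discrepancy at `i` must come from one of its two neighbours in the previous layer.
    by_cases h1 : (permLayer r)^[t] ω (r⁻¹ i) = (permLayer r)^[t] (flipAt k ω) (r⁻¹ i)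
    · by_cases h3 : (permLayer r)^[t] ω (r i) = (permLayer r)^[t] (flipAt k ω) (r i)
      · exact absurd (permLayer_congr r h1 h2 h3) hi
      · rcases ih _ h3 with h | h
        · simpa using h.step_back hn hr h3
        · right
          simpa using h.step hn hr' (by rwa [hL])
    · rcases ih _ h1 with h | h
      · left
        simpa using h.step hn hr h1
      · simpa using (h.step_back hn hr' (by rwa [hL])).symm

/-- If three consecutive pairs of sites carry equal signs, then flipping the middle pair changes
nothing else in any layer. -/
lemma iterate_eq_of_stable_pairs {x y : ι → ℤˣ} {b : ι}
    (hxy : ∀ i, i ≠ (r ^ 2) b → i ≠ (r ^ 3) b → x i = y i)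
    (h₀ : x b = x (r b)) (h₄ : x ((r ^ 4) b) = x ((r ^ 5) b))
    (n₀ : b ≠ (r ^ 2) b ∧ b ≠ (r ^ 3) b) (n₁ : r b ≠ (r ^ 3) b)
    (n₄ : (r ^ 4) b ≠ (r ^ 2) b) (n₅ : (r ^ 5) b ≠ (r ^ 2) b ∧ (r ^ 5) b ≠ (r ^ 3) b)
    (t : ℕ) (i : ι) (hi₂ : i ≠ (r ^ 2) b) (hi₃ : i ≠ (r ^ 3) b) :
    (permLayer r)^[t] x i = (permLayer r)^[t] y i := by
  have p₁ : r b ≠ (r ^ 2) b := by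
    intro h
    exact n₁ (by rw [pow_succ' r 2, Equiv.Perm.mul_apply, ← h, ← Equiv.Perm.mul_apply, ← sq, ← h])
  have p₄ : (r ^ 4) b ≠ (r ^ 3) b := by
    intro h
    rw [pow_succ' r 3, pow_succ' r 2, Equiv.Perm.mul_apply, Equiv.Perm.mul_apply] at h
    exact n₄ (by
      rw [pow_succ' r 3, pow_succ' r 2, Equiv.Perm.mul_apply, Equiv.Perm.mul_apply, h]
      exact r.injective h)
  have h₅ : (r ^ 5) b = r ((r ^ 4) b) := by rw [pow_succ' r 4]; rfl
  have hy₀ : y b = y (r b) := by rw [← hxy _ n₀.1 n₀.2, ← hxy _ p₁ n₁, h₀]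
  have hy₄ : y ((r ^ 4) b) = y ((r ^ 5) b) := by
    rw [← hxy _ n₄ p₄, ← hxy _ n₅.1 n₅.2, h₄]
  rw [h₅] at h₄ hy₄
  induction t generalizing i with
  | zero => exact hxy i hi₂ hi₃
  | succ t ih =>
    -- The sites bordering the middle pair belong to frozen pairs; every other site outside the
    -- middle pair has neighbours outside it, so the induction hypothesis applies.
    by_cases c₁ : i = r b
    · subst c₁
      rw [(iterate_permLayer_stable r h₀ _).2, (iterate_permLayer_stable r hy₀ _).2,
        hxy _ p₁ n₁]
    by_cases c₄ : i = (r ^ 4) b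
    · subst c₄
      rw [(iterate_permLayer_stable r h₄ _).1, (iterate_permLayer_stable r hy₄ _).1,
        hxy _ n₄ p₄]
    rw [Function.iterate_succ_apply', Function.iterate_succ_apply']
    have e₂ : (r ^ 2) b = r (r b) := rfl
    have e₃ : (r ^ 3) b = r ((r ^ 2) b) := rfl
    have e₄ : (r ^ 4) b = r ((r ^ 3) b) := by rw [pow_succ' r 3]; rfl
    refine permLayer_congr r (ih _ ?_ ?_) (ih _ hi₂ hi₃) (ih _ ?_ ?_)
    · intro h
      exact hi₃ (by rw [e₃, ← h, Equiv.apply_symm_apply])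
    · intro h
      exact c₄ (by rw [e₄, ← h, Equiv.apply_symm_apply])
    · intro h
      exact c₁ (r.injective (by rw [h, e₂]))
    · intro h
      exact hi₂ (r.injective (by rw [h, e₃]))

end Dynamics

/-! ### Small-ball estimate from local moves -/

section AntiConcentration

variable {α : Type*} [Fintype α]

/-- Cauchy–Schwarz, with the second moment reduced to its diagonal by orthogonality. -/
lemma sum_abs_sum_le_of_orthogonal (m : ℕ) (X : ℕ → α → ℝ) (hX : ∀ j ω, |X j ω| ≤ 1)
    (horth : ∀ j < m, ∀ l < m, j ≠ l → ∑ ω, X j ω * X l ω = 0) :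
    ∑ ω, |∑ j ∈ Finset.range m, X j ω| ≤ Fintype.card α * √m := by
  have hsq : ∑ ω, (∑ j ∈ Finset.range m, X j ω) ^ 2 ≤ m * Fintype.card α := by
    have h1 : ∑ ω, (∑ j ∈ Finset.range m, X j ω) ^ 2
        = ∑ j ∈ Finset.range m, ∑ l ∈ Finset.range m, ∑ ω, X j ω * X l ω := by
      simp_rw [sq, Finset.sum_mul_sum]
      rw [Finset.sum_comm]
      exact Finset.sum_congr rfl fun j _ => Finset.sum_comm
    rw [h1]
    have h2 : ∀ j ∈ Finset.range m,
        ∑ l ∈ Finset.range m, ∑ ω, X j ω * X l ω ≤ Fintype.card α := by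
      intro j hj
      rw [Finset.sum_eq_single_of_mem j hj fun l hl hlj =>
        horth j (Finset.mem_range.1 hj) l (Finset.mem_range.1 hl) hlj.symm]
      calc ∑ ω, X j ω * X j ω ≤ ∑ _ω : α, (1 : ℝ) :=
            Finset.sum_le_sum fun ω _ => by
              have := abs_le.1 (hX j ω)
              nlinarith [this.1, this.2]
        _ = Fintype.card α := by simp
    calc _ ≤ ∑ j ∈ Finset.range m, (Fintype.card α : ℝ) := Finset.sum_le_sum h2
      _ = _ := by simp
  refine abs_le_of_sq_le_sq' ?_ (by positivity) |>.2
  rw [mul_pow, Real.sq_sqrt (Nat.cast_nonneg m)]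
  calc (∑ ω, |∑ j ∈ Finset.range m, X j ω|) ^ 2
      ≤ Fintype.card α * ∑ ω, |∑ j ∈ Finset.range m, X j ω| ^ 2 := by
        simpa using sq_sum_le_card_mul_sum_sq (s := Finset.univ)
          (f := fun ω => |∑ j ∈ Finset.range m, X j ω|)
    _ ≤ Fintype.card α * (m * Fintype.card α) := by
        simp_rw [sq_abs]
        gcongr
    _ = _ := by ring

/-- Clipping at `K + 4` leaves both `s` and `s - 4u` in the linear range when `|s| ≤ K`; otherwise
monotonicity suffices. -/
lemma four_le_clip_sub {K s u : ℝ} (hu : u = 1 ∨ u = -1) :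
    (if |s| ≤ K then 4 else 0) ≤
      u * (max (-(K + 4)) (min s (K + 4)) - max (-(K + 4)) (min (s - 4 * u) (K + 4))) := by
  rcases hu with rfl | rfl
  · split_ifs with h
    · have := abs_le.1 h
      rw [min_eq_left (by linarith), max_eq_right (by linarith), min_eq_left (by linarith),
        max_eq_right (by linarith)]
      linarith
    · have := max_le_max_left (-(K + 4))
        (min_le_min_right (K + 4) (show s - 4 * 1 ≤ s by linarith))
      linarith
  · split_ifs with h
    · have := abs_le.1 h
      rw [min_eq_left (by linarith), max_eq_right (by linarith), min_eq_left (by linarith),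
        max_eq_right (by linarith)]
      linarith
    · have := max_le_max_left (-(K + 4))
        (min_le_min_right (K + 4) (show s ≤ s - 4 * -1 by linarith))
      linarith

/-- Small-ball estimate for a function `S` on a finite set that has many local moves `τ j`, each of
which changes `S` by `4` on an event `g j` of probability `1/8`. -/
theorem card_abs_le_of_moves (m : ℕ) (S : α → ℝ) (g u : ℕ → α → ℝ) (τ : ℕ → α → α)
    (hg : ∀ j ω, g j ω = 0 ∨ g j ω = 1) (hu : ∀ j ω, u j ω = 1 ∨ u j ω = -1)
    (hτ : ∀ j, Function.Involutive (τ j))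
    (hgτ : ∀ j < m, ∀ l < m, ∀ ω, g l (τ j ω) = g l ω)
    (huτ : ∀ j < m, ∀ l < m, j ≠ l → ∀ ω, u l (τ j ω) = u l ω)
    (huτ' : ∀ j < m, ∀ ω, u j (τ j ω) = -u j ω)
    (hS : ∀ j < m, ∀ ω, g j ω = 1 → S (τ j ω) = S ω - 4 * u j ω)
    (hg₁ : ∀ j < m, ∑ ω, g j ω = Fintype.card α / 8)
    (hg₂ : ∀ j < m, ∀ l < m, j ≠ l → ∑ ω, g j ω * g l ω = Fintype.card α / 64)
    {K : ℝ} (hK : 0 ≤ K) :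
    m * ∑ ω, (if |S ω| ≤ K then (1 : ℝ) else 0) ≤ (4 * K + 24) * √m * Fintype.card α := by
  set N : ℝ := ((Fintype.card α : ℕ) : ℝ)
  set A : α → ℝ := fun ω => if |S ω| ≤ K then (1 : ℝ) else 0 with hA
  set h : ℝ → ℝ := fun s => max (-(K + 4)) (min s (K + 4)) with hh
  have hh_abs : ∀ s, |h s| ≤ K + 4 := fun s =>
    abs_le.2 ⟨le_max_left _ _, max_le (by linarith) (min_le_right _ _)⟩
  have hg0 : ∀ j ω, 0 ≤ g j ω := fun j ω => by rcases hg j ω with h | h <;> simp [h]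
  -- Integration by parts: `τ j` sends `u` to `-u` and `S` to `S - 4u` where `g = 1`, so twice the
  -- right side is the sum of `g u (h(S) - h(S - 4u))`.
  have stein : ∀ j < m, 2 * ∑ ω, g j ω * A ω ≤ ∑ ω, g j ω * u j ω * h (S ω) := by
    intro j hj
    have h1 : ∑ ω, g j ω * u j ω * h (S ω)
        = ∑ ω, -(g j ω * u j ω * h (S ω - 4 * u j ω)) := by
      rw [← sum_comp_involutive (hτ j)]
      refine Finset.sum_congr rfl fun ω _ => ?_
      rw [hgτ j hj j hj, huτ' j hj]
      rcases hg j ω with h0 | h1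
      · simp [h0]
      · rw [hS j hj ω h1]
        ring
    have h2 : ∑ ω, 4 * (g j ω * A ω)
        ≤ ∑ ω, g j ω * u j ω * h (S ω) + ∑ ω, -(g j ω * u j ω * h (S ω - 4 * u j ω)) := by
      rw [← Finset.sum_add_distrib]
      refine Finset.sum_le_sum fun ω _ => ?_
      have := mul_le_mul_of_nonneg_left
        (four_le_clip_sub (K := K) (s := S ω) (hu j ω)) (hg0 j ω)
      have e : (if |S ω| ≤ K then (4 : ℝ) else 0) = 4 * A ω := by
        simp only [hA]; split_ifs <;> norm_num
      rw [e] at this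
      simp only [hh]
      linarith
    rw [← Finset.mul_sum, ← h1] at h2
    linarith
  have hD : ∑ ω, |∑ j ∈ Finset.range m, g j ω * u j ω| ≤ N * √m := by
    refine sum_abs_sum_le_of_orthogonal m _ (fun j ω => ?_) fun j hj l hl hjl => ?_
    · rcases hg j ω with h | h <;> rcases hu j ω with h' | h' <;> simp [h, h']
    · have := sum_comp_involutive (hτ j) (fun ω => g j ω * u j ω * (g l ω * u l ω))
      simp only [hgτ j hj j hj, hgτ j hj l hl, huτ j hj l hl hjl, huτ' j hj] at this
      simp only [mul_neg, neg_mul, Finset.sum_neg_distrib] at this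
      linarith
  have hG : ∑ ω, |∑ j ∈ Finset.range m, (g j ω - 1 / 8)| ≤ N * √m := by
    refine sum_abs_sum_le_of_orthogonal m _ (fun j ω => ?_) fun j hj l hl hjl => ?_
    · rcases hg j ω with h | h <;> rw [h, abs_le] <;> norm_num
    · have e : ∀ ω, (g j ω - 1 / 8) * (g l ω - 1 / 8)
          = g j ω * g l ω - 1 / 8 * g j ω - 1 / 8 * g l ω + 1 / 64 := fun ω => by ring
      simp_rw [e]
      rw [Finset.sum_add_distrib, Finset.sum_sub_distrib, Finset.sum_sub_distrib,
        ← Finset.mul_sum, ← Finset.mul_sum, hg₁ j hj, hg₁ l hl, hg₂ j hj l hl hjl]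
      simp only [Finset.sum_const, Finset.card_univ, nsmul_eq_mul]
      ring
  have hA01 : ∀ ω, 0 ≤ A ω ∧ A ω ≤ 1 := fun ω => by
    simp only [hA]; split_ifs <;> norm_num
  have s1 : 2 * ∑ ω, (∑ j ∈ Finset.range m, g j ω) * A ω ≤ (K + 4) * (N * √m) := by
    calc 2 * ∑ ω, (∑ j ∈ Finset.range m, g j ω) * A ω
        = ∑ j ∈ Finset.range m, 2 * ∑ ω, g j ω * A ω := by
          simp_rw [Finset.sum_mul]
          rw [Finset.sum_comm, Finset.mul_sum]
      _ ≤ ∑ j ∈ Finset.range m, ∑ ω, g j ω * u j ω * h (S ω) :=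
          Finset.sum_le_sum fun j hj => stein j (Finset.mem_range.1 hj)
      _ = ∑ ω, (∑ j ∈ Finset.range m, g j ω * u j ω) * h (S ω) := by
          rw [Finset.sum_comm]
          simp_rw [Finset.sum_mul]
      _ ≤ ∑ ω, (K + 4) * |∑ j ∈ Finset.range m, g j ω * u j ω| := by
          refine Finset.sum_le_sum fun ω _ => (le_abs_self _).trans ?_
          rw [abs_mul, mul_comm]
          gcongr
          exact hh_abs _
      _ ≤ (K + 4) * (N * √m) := by
          rw [← Finset.mul_sum]
          gcongr
  -- The number of active moves concentrates around `m / 8` with error of order `√m`, so it may be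
  -- replaced by its mean.
  have s2 : (m / 8 : ℝ) * ∑ ω, A ω
      ≤ ∑ ω, (∑ j ∈ Finset.range m, g j ω) * A ω + N * √m := by
    refine le_trans ?_ (add_le_add_right hG _)
    rw [Finset.mul_sum, ← Finset.sum_add_distrib]
    refine Finset.sum_le_sum fun ω _ => ?_
    have h1 : ∑ j ∈ Finset.range m, (g j ω - 1 / 8) = ∑ j ∈ Finset.range m, g j ω - m / 8 := by
      rw [Finset.sum_sub_distrib]
      simp
      ring
    rw [h1]
    have h2 := neg_abs_le (∑ j ∈ Finset.range m, g j ω - m / 8)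
    have h3 := abs_nonneg (∑ j ∈ Finset.range m, g j ω - m / 8)
    nlinarith [hA01 ω]
  nlinarith

end AntiConcentration

/-! ### Second moment of the influence of one input -/

section SecondMoment

open Classical in
/-- The length of the alternating run that starts next to `k`, capped at `N`. -/
noncomputable def runLength {ι : Type*} (r : Equiv.Perm ι) (k : ι) (ω : ι → ℤˣ) (N : ℕ) : ℝ :=
  ∑ d ∈ Finset.range N, if AltRun r k ω d then 1 else 0

/-- Raising a partial sum `s ≤ N` by one raises its square by `2s + 1 ≤ 2N + 1`. -/
lemma sq_sum_indicator_le (p : ℕ → Prop) [DecidablePred p] (N : ℕ) :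
    (∑ d ∈ Finset.range N, if p d then (1 : ℝ) else 0) ^ 2
      ≤ ∑ d ∈ Finset.range N, if p d then 2 * (d : ℝ) + 1 else 0 := by
  induction N with
  | zero => simp
  | succ N ih =>
    rw [Finset.sum_range_succ, Finset.sum_range_succ]
    have h : (∑ d ∈ Finset.range N, if p d then (1 : ℝ) else 0) ≤ N := by
      calc _ ≤ ∑ d ∈ Finset.range N, (1 : ℝ) :=
            Finset.sum_le_sum fun d _ => by split_ifs <;> norm_num
        _ = N := by simp
    split_ifs <;> nlinarith

lemma sum_odd_div_two_pow_le (N : ℕ) :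
    ∑ d ∈ Finset.range N, (2 * (d : ℝ) + 1) / 2 ^ d ≤ 6 := by
  have h : ∑ d ∈ Finset.range N, (2 * (d : ℝ) + 1) / 2 ^ d = 6 - (4 * N + 6) / 2 ^ N := by
    induction N with
    | zero => norm_num
    | succ N ih =>
      rw [Finset.sum_range_succ, ih, pow_succ]
      push_cast
      field_simp
      ring
  have : (0 : ℝ) ≤ (4 * N + 6) / 2 ^ N := by positivity
  linarith

variable {ι : Type*} [DecidableEq ι] [Fintype ι] {r : Equiv.Perm ι}

-- Flipping the last site of the run toggles the newest condition and none of the earlier ones, so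
-- each extension costs a factor 2. The bound on `d` keeps the sites distinct.
open Classical in
lemma sum_altRun_eq {n : ℕ} {k : ι}
    (hinj : ∀ a < n, ∀ b < n, (r ^ a) k = (r ^ b) k → a = b) (d : ℕ) (hd : d < n - 1) :
    ∑ ω : ι → ℤˣ, (if AltRun r k ω d then (1 : ℝ) else 0)
      = Fintype.card (ι → ℤˣ) / 2 ^ d := by
  induction d with
  | zero => simp [AltRun]
  | succ d ih =>
    have hne : ∀ e ≤ d, (r ^ (e + 1)) k ≠ (r ^ (d + 2)) k := fun e he h => by
      have := hinj _ (by omega) _ (by omega) h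
      omega
    have h1 : ∀ ω : ι → ℤˣ, AltRun r k ω (d + 1)
        ↔ ω ((r ^ (d + 1)) k) ≠ ω ((r ^ (d + 2)) k) ∧ AltRun r k ω d := by
      intro ω
      refine ⟨fun h => ⟨h d (by omega), fun e he => h e (by omega)⟩, fun h e he => ?_⟩
      rcases Nat.lt_or_ge e d with h2 | h2
      · exact h.2 e h2
      · obtain rfl : e = d := by omega
        exact h.1
    have h2 := sum_ite_eq_half_of_involutive (flipAt_involutive ((r ^ (d + 2)) k))
      (fun ω => ω ((r ^ (d + 1)) k) ≠ ω ((r ^ (d + 2)) k))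
      (fun ω => by
        rw [flipAt_self, flipAt_of_ne (hne d le_rfl)]
        generalize ω ((r ^ (d + 1)) k) = a
        generalize ω ((r ^ (d + 2)) k) = b
        revert a b
        decide)
      (fun ω => if AltRun r k ω d then (1 : ℝ) else 0)
      (fun ω => by
        have : AltRun r k (flipAt ((r ^ (d + 2)) k) ω) d ↔ AltRun r k ω d := by
          refine forall₂_congr fun e he => ?_
          rw [flipAt_of_ne (hne e he.le), flipAt_of_ne (hne (e + 1) he)]
        simp only [this])
    simp_rw [h1, ite_and]
    rw [h2, ih (by omega), pow_succ]
    field_simp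

lemma sum_runLength_sq_le {n : ℕ} {k : ι}
    (hinj : ∀ a < n, ∀ b < n, (r ^ a) k = (r ^ b) k → a = b) :
    ∑ ω : ι → ℤˣ, runLength r k ω (n - 1) ^ 2 ≤ 6 * Fintype.card (ι → ℤˣ) := by
  classical
  calc ∑ ω : ι → ℤˣ, runLength r k ω (n - 1) ^ 2
      ≤ ∑ ω : ι → ℤˣ, ∑ d ∈ Finset.range (n - 1),
          (2 * (d : ℝ) + 1) * (if AltRun r k ω d then 1 else 0) := by
        refine Finset.sum_le_sum fun ω _ => ?_
        refine (sq_sum_indicator_le (fun d => AltRun r k ω d) (n - 1)).trans (le_of_eq ?_)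
        simp only [mul_ite, mul_one, mul_zero]
    _ = ∑ d ∈ Finset.range (n - 1), (2 * (d : ℝ) + 1) / 2 ^ d * Fintype.card (ι → ℤˣ) := by
        rw [Finset.sum_comm]
        refine Finset.sum_congr rfl fun d hd => ?_
        rw [← Finset.mul_sum, sum_altRun_eq hinj d (Finset.mem_range.1 hd)]
        ring
    _ ≤ _ := by
        rw [← Finset.sum_mul]
        gcongr
        exact sum_odd_div_two_pow_le _

lemma card_filter_exists_le (p : ℕ → Prop) [DecidablePred p] (N : ℕ) (f : ℕ → ι)
    [DecidablePred fun i => ∃ d < N, i = f d ∧ p d] :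
    ((Finset.univ.filter fun i => ∃ d < N, i = f d ∧ p d).card : ℝ)
      ≤ ∑ d ∈ Finset.range N, if p d then (1 : ℝ) else 0 := by
  have h : (Finset.univ.filter fun i => ∃ d < N, i = f d ∧ p d)
      ⊆ ((Finset.range N).filter p).image f := by
    intro i hi
    obtain ⟨d, hd, rfl, hp⟩ := (Finset.mem_filter.1 hi).2
    exact Finset.mem_image_of_mem f (by simp [hd, hp])
  rw [Finset.sum_boole]
  exact_mod_cast (Finset.card_le_card h).trans Finset.card_image_le

/-- The sum of all signs in layer `T`. -/
def layerSum (r : Equiv.Perm ι) (T : ℕ) (ω : ι → ℤˣ) : ℝ :=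
  ∑ i, (((permLayer r)^[T] ω i : ℤ) : ℝ)

lemma abs_unit_sub_le (a b : ℤˣ) : |((a : ℤ) : ℝ) - ((b : ℤ) : ℝ)| ≤ if a = b then 0 else 2 := by
  rcases Int.units_eq_one_or a with rfl | rfl <;> rcases Int.units_eq_one_or b with rfl | rfl <;>
    norm_num

lemma abs_layerSum_sub_flipAt_le {n : ℕ} (hn : 0 < n) (hr : r ^ n = 1) (k : ι) (T : ℕ)
    (ω : ι → ℤˣ) :
    |layerSum r T ω - layerSum r T (flipAt k ω)|
      ≤ 2 * (1 + runLength r k ω (n - 1) + runLength r⁻¹ k ω (n - 1)) := by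
  classical
  rw [layerSum, layerSum, ← Finset.sum_sub_distrib]
  refine (Finset.abs_sum_le_sum_abs _ _).trans ?_
  refine (Finset.sum_le_sum fun i _ => abs_unit_sub_le _ _).trans ?_
  simp_rw [← ite_not (_ = _)]
  rw [← Finset.sum_filter, Finset.sum_const, nsmul_eq_mul, mul_comm]
  gcongr
  have hsub : (Finset.univ.filter
        fun i => ¬ (permLayer r)^[T] ω i = (permLayer r)^[T] (flipAt k ω) i)
      ⊆ ({k} ∪ Finset.univ.filter fun i => ∃ d < n - 1, i = (r ^ (d + 1)) k ∧ AltRun r k ω d)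
        ∪ Finset.univ.filter fun i => ∃ d < n - 1, i = (r⁻¹ ^ (d + 1)) k ∧ AltRun r⁻¹ k ω d := by
    intro i hi
    simp only [Finset.mem_union, Finset.mem_singleton, Finset.mem_filter, Finset.mem_univ,
      true_and] at hi ⊢
    rcases reach_of_iterate_ne hn hr T i hi with h | h | h
    · exact Or.inl h
    · exact Or.inl (Or.inl h)
    · exact Or.inr h
  have h1 := (Finset.card_le_card hsub).trans ((Finset.card_union_le _ _).trans
    (Nat.add_le_add_right (Finset.card_union_le _ _) _))
  have h2 := card_filter_exists_le (fun d => AltRun r k ω d) (n - 1) (fun d => (r ^ (d + 1)) k)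
  have h3 := card_filter_exists_le (fun d => AltRun r⁻¹ k ω d) (n - 1)
    (fun d => (r⁻¹ ^ (d + 1)) k)
  have h4 := (Nat.cast_le (α := ℝ)).2 h1
  rw [Finset.card_singleton, Nat.cast_add, Nat.cast_add, Nat.cast_one] at h4
  simp only [runLength]
  linarith

/-- The mean squared effect on the layer sum of flipping one input is bounded, uniformly in the
size of the cycle and the number of layers. -/
theorem sum_layerSum_sub_flipAt_sq_le {n : ℕ} (hn : 0 < n) (hr : r ^ n = 1) {k : ι}
    (hinj : ∀ a < n, ∀ b < n, (r ^ a) k = (r ^ b) k → a = b) (T : ℕ) :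
    ∑ ω : ι → ℤˣ, (layerSum r T ω - layerSum r T (flipAt k ω)) ^ 2
      ≤ 156 * Fintype.card (ι → ℤˣ) := by
  have hinj' : ∀ a < n, ∀ b < n, (r⁻¹ ^ a) k = (r⁻¹ ^ b) k → a = b := by
    intro a ha b hb h
    refine (hinj b hb a ha ?_).symm
    rw [inv_pow, inv_pow, Equiv.Perm.inv_eq_iff_eq] at h
    have h' : (r ^ b) k = (r ^ b) ((r ^ a) (((r ^ b)⁻¹) k)) := congrArg _ h
    rwa [← Equiv.Perm.mul_apply, ← Equiv.Perm.mul_apply, (Commute.pow_pow_self r b a).eq,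
      mul_assoc, mul_inv_cancel, mul_one] at h'
  have h1 := sum_runLength_sq_le hinj
  have h2 := sum_runLength_sq_le hinj'
  -- `(2(1 + x + y))² ≤ 12(1 + x² + y²)`; with second moments at most 6 this gives `12 + 72 + 72 =
  -- 156`.
  have h3 : ∀ ω : ι → ℤˣ, (layerSum r T ω - layerSum r T (flipAt k ω)) ^ 2
      ≤ 12 + 12 * runLength r k ω (n - 1) ^ 2 + 12 * runLength r⁻¹ k ω (n - 1) ^ 2 := by
    intro ω
    have h := abs_layerSum_sub_flipAt_le hn hr k T ω
    rw [← sq_abs]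
    have h' := pow_le_pow_left₀ (abs_nonneg _) h 2
    set x := runLength r k ω (n - 1)
    set y := runLength r⁻¹ k ω (n - 1)
    nlinarith [sq_nonneg (x - y), sq_nonneg (x - 1), sq_nonneg (y - 1)]
  have h4 := Finset.sum_le_sum fun ω (_ : ω ∈ Finset.univ) => h3 ω
  simp only [Finset.sum_add_distrib, ← Finset.mul_sum, Finset.sum_const, Finset.card_univ,
    nsmul_eq_mul] at h4
  linarith

end SecondMoment

/-! ### Blocks of six sites with a free middle pair -/

section Blocks

variable {ι : Type*} [DecidableEq ι]

/-- Flip the signs at two coordinates. -/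
def flipPair (a b : ι) (ω : ι → ℤˣ) : ι → ℤˣ :=
  fun i => if i = a ∨ i = b then -ω i else ω i

lemma flipPair_involutive (a b : ι) : Function.Involutive (flipPair a b) := by
  intro ω
  funext i
  by_cases h : i = a ∨ i = b <;> simp [flipPair, h]

lemma flipPair_left (a b : ι) (ω : ι → ℤˣ) : flipPair a b ω a = -ω a := by
  simp [flipPair]

lemma flipPair_right (a b : ι) (ω : ι → ℤˣ) : flipPair a b ω b = -ω b := by
  simp [flipPair]

lemma flipPair_of_ne {a b i : ι} (ha : i ≠ a) (hb : i ≠ b) (ω : ι → ℤˣ) :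
    flipPair a b ω i = ω i := by
  simp [flipPair, ha, hb]

/-- The `j`-th block of six consecutive sites consists of three pairs of equal signs. -/
def GoodBlock (c : ℕ → ι) (j : ℕ) (ω : ι → ℤˣ) : Prop :=
  ω (c (6 * j)) = ω (c (6 * j + 1)) ∧ ω (c (6 * j + 2)) = ω (c (6 * j + 3)) ∧
    ω (c (6 * j + 4)) = ω (c (6 * j + 5))

instance (c : ℕ → ι) (j : ℕ) (ω : ι → ℤˣ) : Decidable (GoodBlock c j ω) := by
  unfold GoodBlock
  infer_instance

lemma sum_ite_eq_half [Fintype ι] {a b : ι} (hab : a ≠ b) (h : (ι → ℤˣ) → ℝ)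
    (hh : ∀ ω, h (flipAt a ω) = h ω) :
    ∑ ω : ι → ℤˣ, (if ω a = ω b then h ω else 0) = (∑ ω, h ω) / 2 := by
  refine sum_ite_eq_half_of_involutive (flipAt_involutive a) (fun ω => ω a = ω b) (fun ω => ?_)
    h hh
  rw [flipAt_self, flipAt_of_ne hab.symm]
  generalize ω a = x
  generalize ω b = y
  revert x y
  decide

variable {c : ℕ → ι} {n : ℕ}

lemma sum_goodBlock [Fintype ι] (hc : ∀ a < n, ∀ b < n, c a = c b → a = b) {j : ℕ} (hj : 6 * j + 5 < n)
    (h : (ι → ℤˣ) → ℝ)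
    (hh : ∀ a, 6 * j ≤ a → a < 6 * j + 6 → ∀ ω, h (flipAt (c a) ω) = h ω) :
    ∑ ω, (if GoodBlock c j ω then h ω else 0) = (∑ ω, h ω) / 8 := by
  have hne : ∀ a ≤ 6 * j + 5, ∀ b ≤ 6 * j + 5, a ≠ b → c a ≠ c b := fun a ha b hb hab he =>
    hab (hc a (by omega) b (by omega) he)
  simp only [GoodBlock, ite_and]
  rw [sum_ite_eq_half (hne _ (by omega) _ (by omega) (by omega)),
    sum_ite_eq_half (hne _ (by omega) _ (by omega) (by omega)),
    sum_ite_eq_half (hne _ (by omega) _ (by omega) (by omega))]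
  · ring
  · exact hh _ (by omega) (by omega)
  · intro ω
    rw [flipAt_of_ne (hne _ (by omega) _ (by omega) (by omega)),
      flipAt_of_ne (hne _ (by omega) _ (by omega) (by omega)), hh _ (by omega) (by omega)]
  · intro ω
    rw [flipAt_of_ne (hne _ (by omega) _ (by omega) (by omega)),
      flipAt_of_ne (hne _ (by omega) _ (by omega) (by omega)),
      flipAt_of_ne (hne _ (by omega) _ (by omega) (by omega)),
      flipAt_of_ne (hne _ (by omega) _ (by omega) (by omega)), hh _ (by omega) (by omega)]

lemma goodBlock_flipAt (hc : ∀ a < n, ∀ b < n, c a = c b → a = b) {l a : ℕ}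
    (hl : 6 * l + 5 < n) (ha : a < n) (hal : a < 6 * l ∨ 6 * l + 6 ≤ a) (ω : ι → ℤˣ) :
    GoodBlock c l (flipAt (c a) ω) ↔ GoodBlock c l ω := by
  have hne : ∀ i, i < 6 → c (6 * l + i) ≠ c a := fun i hi he => by
    have := hc _ (by omega) _ ha he
    omega
  simp only [GoodBlock]
  rw [flipAt_of_ne (a := c a) (b := c (6 * l)) (hne 0 (by norm_num)), flipAt_of_ne (hne 1 (by norm_num)),
    flipAt_of_ne (hne 2 (by norm_num)), flipAt_of_ne (hne 3 (by norm_num)),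
    flipAt_of_ne (hne 4 (by norm_num)), flipAt_of_ne (hne 5 (by norm_num))]

lemma goodBlock_flipPair (hc : ∀ a < n, ∀ b < n, c a = c b → a = b) {j l : ℕ}
    (hj : 6 * j + 5 < n) (hl : 6 * l + 5 < n) (ω : ι → ℤˣ) :
    GoodBlock c l (flipPair (c (6 * j + 2)) (c (6 * j + 3)) ω) ↔ GoodBlock c l ω := by
  have hne : ∀ a < n, a ≠ 6 * j + 2 → a ≠ 6 * j + 3 →
      flipPair (c (6 * j + 2)) (c (6 * j + 3)) ω (c a) = ω (c a) := fun a ha h₂ h₃ =>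
    flipPair_of_ne (fun he => h₂ (hc _ ha _ (by omega) he))
      (fun he => h₃ (hc _ ha _ (by omega) he)) ω
  simp only [GoodBlock]
  rw [hne (6 * l) (by omega) (by omega) (by omega), hne (6 * l + 1) (by omega) (by omega) (by omega),
    hne (6 * l + 4) (by omega) (by omega) (by omega),
    hne (6 * l + 5) (by omega) (by omega) (by omega)]
  by_cases h : j = l
  · subst h
    rw [flipPair_left, flipPair_right, neg_inj]
  · rw [hne (6 * l + 2) (by omega) (by omega) (by omega),
      hne (6 * l + 3) (by omega) (by omega) (by omega)]

/-- The outer pairs shield all other sites, and the middle pair is frozen before and after the flip,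
so only its two equal signs change in the sum. -/
lemma layerSum_flipPair [Fintype ι] {r : Equiv.Perm ι} {k : ι}
    (hinj : ∀ a < n, ∀ b < n, (r ^ a) k = (r ^ b) k → a = b) {j : ℕ} (hj : 6 * j + 5 < n) (T : ℕ)
    (ω : ι → ℤˣ) (hω : GoodBlock (fun a => (r ^ a) k) j ω) :
    layerSum r T (flipPair ((r ^ (6 * j + 2)) k) ((r ^ (6 * j + 3)) k) ω)
      = layerSum r T ω - 4 * (((ω ((r ^ (6 * j + 2)) k) : ℤˣ) : ℤ) : ℝ) := by
  set c : ℕ → ι := fun a => (r ^ a) k with hc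
  have hω' := (goodBlock_flipPair hinj hj hj ω).2 hω
  set b := c (6 * j) with hb
  have hcb : ∀ i, c (6 * j + i) = (r ^ i) b := fun i => by
    simp only [hc, hb]
    rw [add_comm, pow_add]
    rfl
  have hcb1 : c (6 * j + 1) = r b := hcb 1
  have hne : ∀ i < 6, ∀ l < 6, i ≠ l → (r ^ i) b ≠ (r ^ l) b := fun i hi l hl hil he => by
    rw [← hcb, ← hcb] at he
    have := hinj _ (by omega) _ (by omega) he
    omega
  have h23 := hne 2 (by norm_num) 3 (by norm_num) (by norm_num)
  obtain ⟨g₀, g₂, g₄⟩ := hω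
  obtain ⟨-, g₂', -⟩ := hω'
  change layerSum r T (flipPair (c (6 * j + 2)) (c (6 * j + 3)) ω)
    = layerSum r T ω - 4 * (((ω (c (6 * j + 2)) : ℤˣ) : ℤ) : ℝ)
  change ω b = ω (c (6 * j + 1)) at g₀
  change ω (c (6 * j + 4)) = ω (c (6 * j + 5)) at g₄
  change ω (c (6 * j + 2)) = ω (c (6 * j + 3)) at g₂
  change flipPair (c (6 * j + 2)) (c (6 * j + 3)) ω (c (6 * j + 2))
    = flipPair (c (6 * j + 2)) (c (6 * j + 3)) ω (c (6 * j + 3)) at g₂'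
  have hr3 : (r ^ 3) b = r ((r ^ 2) b) := rfl
  simp only [hcb1, hcb] at g₀ g₂ g₄ g₂' ⊢
  set y := flipPair ((r ^ 2) b) ((r ^ 3) b) ω with hy
  have hoff : ∀ i, i ≠ (r ^ 2) b → i ≠ (r ^ 3) b →
      (permLayer r)^[T] y i = (permLayer r)^[T] ω i := fun i h₂ h₃ =>
    (iterate_eq_of_stable_pairs (fun i h₂ h₃ => (flipPair_of_ne h₂ h₃ ω).symm) g₀ g₄
      ⟨hne 0 (by norm_num) 2 (by norm_num) (by norm_num),
        hne 0 (by norm_num) 3 (by norm_num) (by norm_num)⟩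
      (hne 1 (by norm_num) 3 (by norm_num) (by norm_num))
      (hne 4 (by norm_num) 2 (by norm_num) (by norm_num))
      ⟨hne 5 (by norm_num) 2 (by norm_num) (by norm_num),
        hne 5 (by norm_num) 3 (by norm_num) (by norm_num)⟩ T i h₂ h₃).symm
  rw [hr3] at g₂ g₂'
  have s := iterate_permLayer_stable r g₂ T
  have s' := iterate_permLayer_stable r g₂' T
  rw [← hr3] at s s'
  rw [hy, flipPair_left, flipPair_right, ← hy] at s'
  have hsum : layerSum r T y - layerSum r T ω
      = ∑ i ∈ {(r ^ 2) b, (r ^ 3) b}, ((((permLayer r)^[T] y i : ℤ) : ℝ)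
        - (((permLayer r)^[T] ω i : ℤ) : ℝ)) := by
    rw [layerSum, layerSum, ← Finset.sum_sub_distrib]
    refine (Finset.sum_subset (Finset.subset_univ _) fun i _ hi => ?_).symm
    simp only [Finset.mem_insert, Finset.mem_singleton, not_or] at hi
    rw [hoff i hi.1 hi.2, sub_self]
  rw [Finset.sum_pair h23, s.1, s.2, s'.1, s'.2, hr3, ← g₂] at hsum
  simp only [Units.val_neg, Int.cast_neg] at hsum
  linarith

/-- Small-ball estimate for the layer sum, uniform in the number of layers. -/
theorem card_abs_layerSum_le [Fintype ι] {r : Equiv.Perm ι} {k : ι}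
    (hinj : ∀ a < n, ∀ b < n, (r ^ a) k = (r ^ b) k → a = b) {m : ℕ} (hm : 6 * m ≤ n) (T : ℕ)
    {K : ℝ} (hK : 0 ≤ K) :
    m * ∑ ω : ι → ℤˣ, (if |layerSum r T ω| ≤ K then (1 : ℝ) else 0)
      ≤ (4 * K + 24) * √m * Fintype.card (ι → ℤˣ) := by
  set c : ℕ → ι := fun a => (r ^ a) k with hc
  have hgood : ∀ j < m, ∑ ω, (if GoodBlock c j ω then (1 : ℝ) else 0)
      = Fintype.card (ι → ℤˣ) / 8 := fun j hj => by
    rw [sum_goodBlock hinj (by omega) (fun _ => 1) (fun _ _ _ _ => rfl)]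
    simp
  refine card_abs_le_of_moves m (layerSum r T)
    (fun j ω => if GoodBlock c j ω then 1 else 0)
    (fun j ω => (((ω (c (6 * j + 2)) : ℤˣ) : ℤ) : ℝ))
    (fun j => flipPair (c (6 * j + 2)) (c (6 * j + 3)))
    (fun j ω => by by_cases h : GoodBlock c j ω <;> simp [h])
    (fun j ω => by
      rcases Int.units_eq_one_or (ω (c (6 * j + 2))) with h | h <;> simp [h])
    (fun j => flipPair_involutive _ _)
    (fun j hj l hl ω => by
      simp only [goodBlock_flipPair (c := c) hinj (show 6 * j + 5 < n by omega)
        (show 6 * l + 5 < n by omega) ω])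
    (fun j hj l hl hjl ω => ?_)
    (fun j hj ω => ?_)
    (fun j hj ω hω => ?_) hgood (fun j hj l hl hjl => ?_) hK
  · rw [flipPair_of_ne]
    · intro he
      have := hinj _ (by omega) _ (by omega) he
      omega
    · intro he
      have := hinj _ (by omega) _ (by omega) he
      omega
  · rw [flipPair_left]
    push_cast
    rfl
  · refine layerSum_flipPair hinj (by omega) T ω ?_
    by_contra h
    simp only [hc] at hω
    rw [if_neg h] at hω
    norm_num at hω
  · simp only [ite_mul, one_mul, zero_mul]
    rw [sum_goodBlock (c := c) hinj (by omega), hgood l hl]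
    · ring
    · intro a ha ha' ω
      simp only [goodBlock_flipAt (c := c) hinj (show 6 * l + 5 < n by omega)
        (show a < n by omega) (by omega) ω]

end Blocks

/-! ### The cyclic shift as a single `n`-cycle -/

lemma val_finRotate_pow {n : ℕ} (a : ℕ) (k : Fin n) :
    ((finRotate n ^ a) k : ℕ) = (k + a) % n := by
  obtain _ | n := n
  · exact k.elim0
  induction a with
  | zero => simp [Nat.mod_eq_of_lt k.isLt]
  | succ a ih =>
    rw [pow_succ', Equiv.Perm.mul_apply, finRotate_apply, Fin.val_add, ih, Fin.val_one',
      ← Nat.add_mod, add_assoc]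

lemma finRotate_pow_self (n : ℕ) : finRotate n ^ n = 1 := by
  ext k
  rw [val_finRotate_pow, Nat.add_mod_right, Nat.mod_eq_of_lt k.isLt]
  rfl

lemma finRotate_pow_injOn {n : ℕ} (k : Fin n) :
    ∀ a < n, ∀ b < n, (finRotate n ^ a) k = (finRotate n ^ b) k → a = b := by
  intro a ha b hb h
  have h' := congrArg Fin.val h
  rw [val_finRotate_pow, val_finRotate_pow] at h'
  exact Nat.ModEq.eq_of_lt_of_lt (Nat.ModEq.add_left_cancel' (k : ℕ) h') ha hb

/-! ### From measures to finite weighted sums -/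

section NoiseLaw

instance (p : ℝ) : IsFiniteMeasure (signLaw p) := by
  unfold signLaw
  constructor
  simp

lemma signLaw_singleton (p : ℝ) (s : ℤˣ) :
    signLaw p {s} = ENNReal.ofReal (if s = 1 then 1 - p else p) := by
  rcases Int.units_eq_one_or s with rfl | rfl
  · simp [signLaw]
  · simp [signLaw]

lemma pi_signLaw_singleton {n : ℕ} {ε : ℝ} (h0 : 0 ≤ ε) (h1 : ε ≤ 1) (η : Fin n → ℤˣ) :
    (Measure.pi fun _ => signLaw ε) {η} = ENNReal.ofReal (noiseWeight ε η) := by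
  rw [Measure.pi_singleton, noiseWeight, ENNReal.ofReal_prod_of_nonneg]
  · simp_rw [signLaw_singleton]
  · intro i _
    split_ifs <;> linarith

lemma noiseWeight_half {n : ℕ} (η : Fin n → ℤˣ) :
    noiseWeight (1 / 2) η = ((Fintype.card (Fin n → ℤˣ) : ℕ) : ℝ)⁻¹ := by
  have h : ∀ s : ℤˣ, (if s = 1 then 1 - (1 / 2 : ℝ) else 1 / 2) = 1 / 2 := fun s => by
    split_ifs <;> norm_num
  simp only [noiseWeight, h]
  simp

lemma disagreementProb_eq {n : ℕ} (f : (Fin n → ℤˣ) → ℤˣ) {ε : ℝ} (h0 : 0 ≤ ε) (h1 : ε ≤ 1) :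
    disagreementProb f ε = ENNReal.ofReal ((Fintype.card (Fin n → ℤˣ) : ℝ)⁻¹ *
      ∑ ω, ∑ η, noiseWeight ε η * (if f ω = f (ω * η) then 0 else 1)) := by
  classical
  have hs : {p : (Fin n → ℤˣ) × (Fin n → ℤˣ) | f p.1 ≠ f (p.1 * p.2)}
      = ((Finset.univ.filter fun p : (Fin n → ℤˣ) × (Fin n → ℤˣ) => f p.1 ≠ f (p.1 * p.2) :
        Finset _) : Set _) := by
    ext; simp
  have hsing : ∀ p : (Fin n → ℤˣ) × (Fin n → ℤˣ), noiseLaw n ε {p}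
      = ENNReal.ofReal ((Fintype.card (Fin n → ℤˣ) : ℝ)⁻¹ * noiseWeight ε p.2) := by
    rintro ⟨ω, η⟩
    rw [noiseLaw, ← Set.singleton_prod_singleton, Measure.prod_prod,
      pi_signLaw_singleton (by norm_num) (by norm_num), pi_signLaw_singleton h0 h1,
      noiseWeight_half, ← ENNReal.ofReal_mul (by positivity)]
  rw [disagreementProb, hs, ← sum_measure_singleton]
  simp_rw [hsing]
  rw [← ENNReal.ofReal_sum_of_nonneg fun p _ =>
    mul_nonneg (by positivity) (noiseWeight_nonneg h0 h1 _)]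
  congr 1
  rw [Finset.sum_filter, Fintype.sum_prod_type, Finset.mul_sum]
  refine Finset.sum_congr rfl fun ω _ => ?_
  rw [Finset.mul_sum]
  refine Finset.sum_congr rfl fun η _ => ?_
  by_cases h : f ω = f (ω * η) <;> simp [h]

end NoiseLaw

/-! ### Bounds on the disagreement probability -/

section Bounds

lemma disagreementProb_le_mul {n : ℕ} (f : (Fin n → ℤˣ) → ℤˣ) {ε : ℝ} (h0 : 0 ≤ ε) (h1 : ε ≤ 1) :
    disagreementProb f ε ≤ ENNReal.ofReal (n * ε) := by
  rw [disagreementProb_eq f h0 h1]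
  refine ENNReal.ofReal_le_ofReal ?_
  set g : (Fin n → ℤˣ) → ℝ := fun ω => if f ω = 1 then 1 else 0 with hg
  have hsq : ∀ x y : Fin n → ℤˣ, (g x - g y) ^ 2 = if f x = f y then 0 else 1 := by
    intro x y
    simp only [hg]
    rcases Int.units_eq_one_or (f x) with h | h <;>
      rcases Int.units_eq_one_or (f y) with h' | h' <;> rw [h, h'] <;>
      norm_num [show (-1 : ℤˣ) ≠ 1 by decide, show (1 : ℤˣ) ≠ -1 by decide]
  have h := noise_sq_le h0 h1 n g
  have hb : ∑ k, ∑ ω, (g ω - g (flipAt k ω)) ^ 2 ≤ n * Fintype.card (Fin n → ℤˣ) := by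
    calc _ ≤ ∑ _k : Fin n, ∑ _ω : Fin n → ℤˣ, (1 : ℝ) := by
          refine Finset.sum_le_sum fun k _ => Finset.sum_le_sum fun ω _ => ?_
          rw [hsq]
          split_ifs <;> norm_num
      _ = _ := by simp
  simp_rw [hsq] at h hb
  have hN : (0 : ℝ) < Fintype.card (Fin n → ℤˣ) := by exact_mod_cast Fintype.card_pos
  rw [inv_mul_le_iff₀ hN]
  calc _ ≤ _ := h
    _ ≤ ε * (n * Fintype.card (Fin n → ℤˣ)) := by gcongr
    _ = _ := by ring

lemma cycleIteratedMajority_eq (n T : ℕ) (ω : Fin n → ℤˣ) :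
    cycleIteratedMajority n T ω = if 0 < layerSum (finRotate n) T ω then 1 else -1 := by
  have h : layerSum (finRotate n) T ω = ((∑ i, ((cycleLayer n)^[T] ω i : ℤ) : ℤ) : ℝ) := by
    push_cast
    rfl
  rw [h, cycleIteratedMajority, majority]
  simp only [Int.cast_pos]

/-- If `|s| > K`, the signs can differ only when `|s - t| ≥ K`; the last term is the Chebyshev bound
for that. -/
lemma ite_sign_ne_le {s t K : ℝ} (hK : 0 < K) :
    (if (if 0 < s then (1 : ℤˣ) else -1) = (if 0 < t then 1 else -1) then (0 : ℝ) else 1)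
      ≤ (if |s| ≤ K then 1 else 0) + (K ^ 2)⁻¹ * (s - t) ^ 2 := by
  have h0 : 0 ≤ (K ^ 2)⁻¹ * (s - t) ^ 2 := by positivity
  by_cases hs : |s| ≤ K
  · rw [if_pos hs]
    split_ifs <;> linarith
  rw [if_neg hs]
  by_cases hd : |s - t| < K
  · have h1 := abs_lt.1 hd
    rw [if_pos]
    · linarith
    rcases lt_abs.1 (not_le.1 hs) with h | h
    · rw [if_pos (by linarith), if_pos (by linarith)]
    · rw [if_neg (by linarith), if_neg (by linarith)]
  · have h2 : K ^ 2 ≤ (s - t) ^ 2 := by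
      rw [← sq_abs (s - t)]
      exact pow_le_pow_left₀ hK.le (not_lt.1 hd) 2
    have h3 : 1 ≤ (K ^ 2)⁻¹ * (s - t) ^ 2 := by
      rw [le_inv_mul_iff₀ (by positivity)]
      linarith
    split_ifs <;> linarith

/-- Bound on the noise sensitivity, uniform in the number of layers. -/
lemma disagreementProb_cycleIteratedMajority_le {n : ℕ} (hn : 6 ≤ n) (T : ℕ) {ε a : ℝ}
    (h0 : 0 ≤ ε) (h1 : ε ≤ 1) (ha : 0 < a) :
    disagreementProb (cycleIteratedMajority n T) ε
      ≤ ENNReal.ofReal (4 * a + 24 / √((n / 6 : ℕ) : ℝ) + 1872 * ε / a ^ 2) := by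
  rw [disagreementProb_eq _ h0 h1]
  refine ENNReal.ofReal_le_ofReal ?_
  set m := n / 6 with hm
  have hm0 : (0 : ℝ) < m := by exact_mod_cast (show 0 < m by omega)
  have hsm : (0 : ℝ) < √(m : ℝ) := Real.sqrt_pos.2 hm0
  have hN : (0 : ℝ) < Fintype.card (Fin n → ℤˣ) := by exact_mod_cast Fintype.card_pos
  set N : ℝ := ((Fintype.card (Fin n → ℤˣ) : ℕ) : ℝ)
  set S := layerSum (finRotate n) T with hS
  set K := a * √(m : ℝ) with hK
  have hK0 : 0 < K := by positivity
  have hK2 : K ^ 2 = a ^ 2 * m := by rw [hK, mul_pow, Real.sq_sqrt hm0.le]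
  have b1 := card_abs_layerSum_le (finRotate_pow_injOn (⟨0, by omega⟩ : Fin n))
    (show 6 * m ≤ n by omega) T hK0.le
  have b1' : ∑ ω, (if |S ω| ≤ K then (1 : ℝ) else 0) ≤ (4 * a + 24 / √(m : ℝ)) * N := by
    rw [← le_div_iff₀' hm0] at b1
    refine b1.trans (le_of_eq ?_)
    rw [div_eq_iff hm0.ne']
    have : (m : ℝ) = √(m : ℝ) * √(m : ℝ) := (Real.mul_self_sqrt hm0.le).symm
    have e : (4 * a + 24 / √(m : ℝ)) * N * (√(m : ℝ) * √(m : ℝ))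
        = (4 * K + 24) * √(m : ℝ) * N := by
      rw [hK]
      field_simp
    rw [← e, ← this]
  have b2 : ∑ ω, ∑ η, noiseWeight ε η * (S ω - S (ω * η)) ^ 2 ≤ ε * (n * (156 * N)) := by
    refine (noise_sq_le h0 h1 n S).trans (mul_le_mul_of_nonneg_left ?_ h0)
    calc _ ≤ ∑ _k : Fin n, 156 * N := Finset.sum_le_sum fun k _ =>
          sum_layerSum_sub_flipAt_sq_le (by omega) (finRotate_pow_self n)
            (finRotate_pow_injOn k) T
      _ = _ := by simp
  -- Uses `n ≥ 6`, so that `n < 6(m + 1) ≤ 12m`; then `12 · 156 = 1872`.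
  have hnm : (n : ℝ) ≤ 12 * m := by exact_mod_cast (show n ≤ 12 * m by omega)
  rw [inv_mul_le_iff₀ hN]
  calc ∑ ω, ∑ η, noiseWeight ε η *
        (if cycleIteratedMajority n T ω = cycleIteratedMajority n T (ω * η) then (0 : ℝ) else 1)
      ≤ ∑ ω, ∑ η, (noiseWeight ε η * (if |S ω| ≤ K then (1 : ℝ) else 0)
          + (K ^ 2)⁻¹ * (noiseWeight ε η * (S ω - S (ω * η)) ^ 2)) := by
        refine Finset.sum_le_sum fun ω _ => Finset.sum_le_sum fun η _ => ?_
        rw [cycleIteratedMajority_eq, cycleIteratedMajority_eq]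
        have := mul_le_mul_of_nonneg_left (ite_sign_ne_le (s := S ω) (t := S (ω * η)) hK0)
          (noiseWeight_nonneg h0 h1 η)
        linarith
    _ = ∑ ω, (if |S ω| ≤ K then (1 : ℝ) else 0)
          + (K ^ 2)⁻¹ * ∑ ω, ∑ η, noiseWeight ε η * (S ω - S (ω * η)) ^ 2 := by
        simp only [Finset.sum_add_distrib, ← Finset.mul_sum]
        rw [sum_sum_noise_const ε (fun ω => if |S ω| ≤ K then (1 : ℝ) else 0)]
    _ ≤ (4 * a + 24 / √(m : ℝ)) * N + (a ^ 2 * m)⁻¹ * (ε * (12 * m * (156 * N))) := by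
        rw [hK2]
        gcongr
        exact b2.trans (by gcongr)
    _ = _ := by
        field_simp
        ring

end Bounds

theorem mainTheorem8 (T : ℕ → ℕ) :
    NoiseStable (fun n : {n : ℕ // Odd n} => cycleIteratedMajority (n : ℕ) (T n)) := by
  rw [NoiseStable, ENNReal.tendsto_nhds_zero]
  intro δ' hδ'
  obtain ⟨δ, hδ, hδδ'⟩ : ∃ δ : ℝ, 0 < δ ∧ ENNReal.ofReal δ ≤ δ' := by
    obtain ⟨x, hx, hxδ⟩ := ENNReal.lt_iff_exists_nnreal_btwn.1 hδ'
    exact ⟨x, by exact_mod_cast hx, by rw [ENNReal.ofReal_coe_nnreal]; exact hxδ.le⟩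
  obtain ⟨M, hM⟩ := exists_nat_gt ((96 / δ) ^ 2)
  have hM0 : (0 : ℝ) < M := lt_of_le_of_lt (by positivity) hM
  -- With `a = δ / 16` each of the three error terms is at most `δ / 4`; here `1916928 = 1872 · 16²
  -- · 4`. The last entry handles `n < 6M`.
  have hc : 0 < min 1 (min (δ ^ 3 / 1916928) (δ / (6 * M))) := by positivity
  filter_upwards [Ioo_mem_nhdsGT hc] with ε hε
  obtain ⟨h0, hlt⟩ := hε
  obtain ⟨h1, h2, h3⟩ : ε < 1 ∧ ε < δ ^ 3 / 1916928 ∧ ε < δ / (6 * M) := by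
    simpa only [lt_min_iff] using hlt
  refine iSup_le fun n => ?_
  refine le_trans ?_ hδδ'
  rcases Nat.lt_or_ge (n : ℕ) (6 * M) with hn | hn
  · refine (disagreementProb_le_mul _ h0.le h1.le).trans (ENNReal.ofReal_le_ofReal ?_)
    rw [lt_div_iff₀ (by positivity)] at h3
    have : ((n : ℕ) : ℝ) ≤ 6 * M := by exact_mod_cast hn.le
    nlinarith
  · have hMpos : 0 < M := by exact_mod_cast hM0
    refine (disagreementProb_cycleIteratedMajority_le (a := δ / 16) (by omega) _ h0.le h1.le
      (by positivity)).trans (ENNReal.ofReal_le_ofReal ?_)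
    have hs : 96 / δ ≤ √(((n : ℕ) / 6 : ℕ) : ℝ) := by
      refine Real.le_sqrt_of_sq_le (hM.le.trans ?_)
      exact_mod_cast (show M ≤ (n : ℕ) / 6 by omega)
    have hs' : 24 / √(((n : ℕ) / 6 : ℕ) : ℝ) ≤ δ / 4 := by
      rw [div_le_iff₀ (lt_of_lt_of_le (by positivity) hs)]
      calc (24 : ℝ) = δ / 4 * (96 / δ) := by field_simp; norm_num
        _ ≤ _ := by gcongr
    have he : 1872 * ε / (δ / 16) ^ 2 ≤ δ / 4 := by
      rw [div_le_iff₀ (by positivity)]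
      nlinarith
    linarith
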